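/- Consider a binomial market with horizon $T\in\mathbb N$, a bond of constant price $1$, and a stock with price $P_k=S\,a_1\cdots a_k$, $0\le k\le T$, where $S>0$ and $a_1,\dots,a_T$ are independent with $P(a_i=u)=p$, $P(a_i=d)=1-p$, $0<d<1<u$, $0<p<1$. Let $\lambda_0>0$ and $\lambda_1>0$ be the proportional costs for buying and for selling the stock, and put $h(z)=(1+\lambda_0)z$ for $z>0$ and $h(z)=(1-\lambda_1)z$ for $z\le 0$. A strategy is a real process $I=(I(k))_{0\le k\le T}$ adapted to the filtration generated by the stock price, where $I(k)$ is the number of shares bought (sold, if negative) at time $k$. Starting from $x_0$ units of the bond and $x_1$ shares, it leads to the holdings $$X^0(k)=x_0-\sum_{l=0}^k h(I(l))P_l,\qquad X^1(k)=x_1+\sum_{l=0}^k I(l),$$ and $I$ is admissible if $X^0(k)-h(-X^1(k))P_k\ge 0$ for $k=0,\dots,T$. Let $0<\gamma<1$ and $U(x)=x^\gamma/\gamma$. An admissible strategy is optimal if it maximizes $E\big[U\big(X^0(T)-h(-X^1(T))P_T\big)\big]$ among all admissible strategies. Assume $x_0-h(-x_1)S>0$, and let $\hat I$ be the strategy with $\hat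 I(0)=-x_1$ and $\hat I(k)=0$ for $1\le k\le T$. (1) If $pu+(1-p)d>1$, $(1-\lambda_1)(pu+(1-p)d)^T\le 1+\lambda_0$ and $x_1\le 0$, then $\hat I$ (buy-and-hold: buy back the $-x_1$ shares at time $0$, then do not trade) is optimal. (2) If $\lambda_1\le 1$, $pu+(1-p)d<1$, $(1+\lambda_0)(pu+(1-p)d)^T\ge 1-\lambda_1$ and $x_1\ge 0$, then $\hat I$ (sell-and-hold: sell the $x_1$ shares at time $0$, then do not trade) is optimal. -/

import Mathlib

/-- Parameters of a binomial market with one stock and a bond of constant price `1`, with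
proportional transaction costs. -/
structure BinomialMarket where
  /-- time horizon -/
  T : ℕ
  /-- up factor -/
  u : ℝ
  /-- down factor -/
  d : ℝ
  /-- probability of an up move -/
  p : ℝ
  /-- initial stock price -/
  S : ℝ
  /-- proportional cost for buying the stock -/
  lam0 : ℝ
  /-- proportional cost for selling the stock -/
  lam1 : ℝ
  d_pos : 0 < d
  d_lt_one : d < 1
  one_lt_u : 1 < u
  p_pos : 0 < p
  p_lt_one : p < 1
  S_pos : 0 < S
  lam0_pos : 0 < lam0
  lam1_pos : 0 < lam1

namespace BinomialMarket

/-- Sample space: `ω i = true` iff the `(i+1)`-st move of the stock is up. -/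
abbrev Sample (M : BinomialMarket) : Type := Fin M.T → Bool

/-- The factor `a_{i+1} ∈ {u, d}`. -/
noncomputable def factor (M : BinomialMarket) (ω : M.Sample) (i : Fin M.T) : ℝ :=
  if ω i = true then M.u else M.d

/-- Stock price `S a_1 ⋯ a_k` at time `k`. -/
noncomputable def price (M : BinomialMarket) (k : ℕ) (ω : M.Sample) : ℝ :=
  M.S * ∏ i ∈ Finset.univ.filter (fun i : Fin M.T => (i : ℕ) < k), M.factor ω i

/-- Number of up moves. -/
def ups (M : BinomialMarket) (ω : M.Sample) : ℕ :=
  (Finset.univ.filter (fun i : Fin M.T => ω i = true)).card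

/-- Probability `p^m (1-p)^(T-m)` of the path `ω`, where `m` is its number of up moves. -/
noncomputable def prob (M : BinomialMarket) (ω : M.Sample) : ℝ :=
  M.p ^ M.ups ω * (1 - M.p) ^ (M.T - M.ups ω)

/-- Expectation on the finite sample space. -/
noncomputable def expect (M : BinomialMarket) (X : M.Sample → ℝ) : ℝ :=
  ∑ ω, M.prob ω * X ω

/-- Expected one-period growth factor of the stock. -/
noncomputable def meanGrowth (M : BinomialMarket) : ℝ := M.p * M.u + (1 - M.p) * M.d

/-- Cash needed, per unit of stock price, to buy `z` shares (`z > 0`), or minus the cash obtained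
from selling `-z` shares (`z ≤ 0`). -/
noncomputable def cost (M : BinomialMarket) (z : ℝ) : ℝ :=
  if 0 < z then (1 + M.lam0) * z else (1 - M.lam1) * z

/-- A trading process: `I k ω` is the number of shares bought at time `k` (sold if negative).
Only the times `k = 0, …, T` matter. -/
abbrev Strategy (M : BinomialMarket) : Type := ℕ → M.Sample → ℝ

/-- `I k` depends only on the first `k` moves, for `k = 0, …, T`. -/
def Adapted (M : BinomialMarket) (I : M.Strategy) : Prop :=
  ∀ k ≤ M.T, ∀ ω ω' : M.Sample, (∀ i : Fin M.T, (i : ℕ) < k → ω i = ω' i) → I k ω = I k ω'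

/-- Bond holdings after trading at time `k`. -/
noncomputable def bond (M : BinomialMarket) (x0 : ℝ) (I : M.Strategy) (k : ℕ)
    (ω : M.Sample) : ℝ :=
  x0 - ∑ l ∈ Finset.range (k + 1), M.cost (I l ω) * M.price l ω

/-- Number of shares held after trading at time `k`. -/
noncomputable def stock (M : BinomialMarket) (x1 : ℝ) (I : M.Strategy) (k : ℕ)
    (ω : M.Sample) : ℝ :=
  x1 + ∑ l ∈ Finset.range (k + 1), I l ω

/-- Liquidation value of the portfolio after trading at time `k`. -/
noncomputable def wealth (M : BinomialMarket) (x0 x1 : ℝ) (I : M.Strategy) (k : ℕ)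
    (ω : M.Sample) : ℝ :=
  M.bond x0 I k ω - M.cost (-(M.stock x1 I k ω)) * M.price k ω

/-- Admissible strategies: adapted, with nonnegative liquidation value at all times. -/
def Admissible (M : BinomialMarket) (x0 x1 : ℝ) (I : M.Strategy) : Prop :=
  M.Adapted I ∧ ∀ k ≤ M.T, ∀ ω, 0 ≤ M.wealth x0 x1 I k ω

/-- Expected utility of the terminal liquidation value, for a utility function `U`. -/
noncomputable def expectedUtility (M : BinomialMarket) (U : ℝ → ℝ) (x0 x1 : ℝ)
    (I : M.Strategy) : ℝ :=
  M.expect (fun ω => U (M.wealth x0 x1 I M.T ω))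

/-- `I` is admissible and maximizes expected utility among all admissible strategies. -/
def IsOptimal (M : BinomialMarket) (U : ℝ → ℝ) (x0 x1 : ℝ) (I : M.Strategy) : Prop :=
  M.Admissible x0 x1 I ∧
    ∀ J : M.Strategy, M.Admissible x0 x1 J →
      M.expectedUtility U x0 x1 J ≤ M.expectedUtility U x0 x1 I

/-- Close the initial position of `x1` shares at time `0` and never trade again. For `x1 ≤ 0`
this buys `-x1` shares (buy-and-hold); for `x1 ≥ 0` it sells `x1` shares (sell-and-hold). -/
def closeAndHold (M : BinomialMarket) (x1 : ℝ) : M.Strategy :=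
  fun k _ => if k = 0 then -x1 else 0

end BinomialMarket

/-- Power utility `x^γ / γ`. -/
noncomputable def powerUtility (γ : ℝ) (x : ℝ) : ℝ := 1 / γ * x ^ γ

namespace BinomialMarket

variable (M : BinomialMarket)

/-! The proof exhibits a shadow price. With `m` the mean growth, `Z k = c m⁻ᵏ Pₖ` is a martingale;
if it stays in the bid-ask spread `[(1 - λ₁) Pₖ, (1 + λ₀) Pₖ]`, trading at `Z` without costs is
never worse than trading at `P` with costs. Frictionless trading in a martingale has zero expected
gain, so every strategy has expected terminal wealth at most `x0 + x1 c S` (`expect_wealth_le`).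

Taking `c` as the side of the spread at which the initial position is closed makes this bound the
certain wealth of closing at once, and Jensen's inequality turns the bound on means into one on
utilities (`isOptimal_closeAndHold`). The condition on `m ^ T` is what keeps `Z` in the spread up to
the horizon. -/

/-! ### Product measure and expectation. -/

/-- The product form exposes the independence of the moves: changing one move changes one factor. -/
lemma prob_eq_prod (ω : M.Sample) :
    M.prob ω = ∏ i, (if ω i = true then M.p else 1 - M.p) := by
  have hcard : (Finset.univ.filter (fun i : Fin M.T => ¬ ω i = true)).card = M.T - M.ups ω := by
    have h := Finset.card_filter_add_card_filter_not (s := (Finset.univ : Finset (Fin M.T)))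
      (fun i => ω i = true)
    rw [Finset.card_univ, Fintype.card_fin] at h
    unfold ups
    omega
  rw [Finset.prod_ite, Finset.prod_const, Finset.prod_const, hcard]
  rfl

lemma prob_nonneg (ω : M.Sample) : 0 ≤ M.prob ω :=
  mul_nonneg (pow_nonneg M.p_pos.le _) (pow_nonneg (sub_nonneg.2 M.p_lt_one.le) _)

lemma sum_prob : ∑ ω, M.prob ω = 1 := by
  simp_rw [prob_eq_prod]
  have h := Finset.prod_univ_sum (fun _ : Fin M.T => (Finset.univ : Finset Bool))
    (fun _ b => if b = true then M.p else 1 - M.p)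
  rw [Fintype.piFinset_univ] at h
  rw [← h]
  simp

lemma expect_mono {X Y : M.Sample → ℝ} (h : ∀ ω, X ω ≤ Y ω) : M.expect X ≤ M.expect Y :=
  Finset.sum_le_sum fun ω _ => mul_le_mul_of_nonneg_left (h ω) (M.prob_nonneg ω)

lemma expect_nonneg {X : M.Sample → ℝ} (h : ∀ ω, 0 ≤ X ω) : 0 ≤ M.expect X :=
  Finset.sum_nonneg fun ω _ => mul_nonneg (M.prob_nonneg ω) (h ω)

lemma expect_const (c : ℝ) : M.expect (fun _ => c) = c := by
  rw [expect, ← Finset.sum_mul, sum_prob, one_mul]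

lemma expect_add (X Y : M.Sample → ℝ) :
    M.expect (fun ω => X ω + Y ω) = M.expect X + M.expect Y := by
  simp only [expect, mul_add, Finset.sum_add_distrib]

lemma expect_sub (X Y : M.Sample → ℝ) :
    M.expect (fun ω => X ω - Y ω) = M.expect X - M.expect Y := by
  simp only [expect, mul_sub, Finset.sum_sub_distrib]

lemma expect_const_mul (c : ℝ) (X : M.Sample → ℝ) :
    M.expect (fun ω => c * X ω) = c * M.expect X := by
  simp only [expect, Finset.mul_sum]
  exact Finset.sum_congr rfl fun ω _ => mul_left_comm _ _ _

lemma expect_sum (s : Finset ℕ) (X : ℕ → M.Sample → ℝ) :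
    M.expect (fun ω => ∑ l ∈ s, X l ω) = ∑ l ∈ s, M.expect (X l) := by
  simp only [expect, Finset.mul_sum]
  exact Finset.sum_comm

/-- Jensen's inequality on the finite sample space. -/
lemma expect_comp_le_of_concaveOn {U : ℝ → ℝ} (hU : ConcaveOn ℝ (Set.Ici 0) U)
    {X : M.Sample → ℝ} (hX : ∀ ω, 0 ≤ X ω) : M.expect (fun ω => U (X ω)) ≤ U (M.expect X) := by
  have h := hU.le_map_sum (t := Finset.univ) (w := M.prob) (p := X)
    (fun ω _ => M.prob_nonneg ω) M.sum_prob (fun ω _ => hX ω)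
  simpa only [smul_eq_mul, expect] using h

lemma factor_pos (ω : M.Sample) (i : Fin M.T) : 0 < M.factor ω i := by
  unfold factor
  split_ifs
  · exact zero_lt_one.trans M.one_lt_u
  · exact M.d_pos

lemma price_pos (k : ℕ) (ω : M.Sample) : 0 < M.price k ω :=
  mul_pos M.S_pos (Finset.prod_pos fun i _ => M.factor_pos ω i)

lemma price_zero (ω : M.Sample) : M.price 0 ω = M.S := by
  simp [price]

lemma price_succ {k : ℕ} (hk : k < M.T) (ω : M.Sample) :
    M.price (k + 1) ω = M.price k ω * M.factor ω ⟨k, hk⟩ := by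
  have h : Finset.univ.filter (fun i : Fin M.T => (i : ℕ) < k + 1)
      = insert ⟨k, hk⟩ (Finset.univ.filter (fun i : Fin M.T => (i : ℕ) < k)) := by
    ext i
    simp only [Finset.mem_filter, Finset.mem_univ, true_and, Finset.mem_insert, Fin.ext_iff]
    omega
  rw [price, h, Finset.prod_insert (by simp), price]
  ring

lemma price_congr {k : ℕ} {ω ω' : M.Sample} (h : ∀ i : Fin M.T, (i : ℕ) < k → ω i = ω' i) :
    M.price k ω = M.price k ω' := by
  unfold price factor
  congr 1
  refine Finset.prod_congr rfl fun i hi => ?_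
  rw [h i (Finset.mem_filter.1 hi).2]

lemma meanGrowth_pos : 0 < M.meanGrowth :=
  add_pos (mul_pos M.p_pos (zero_lt_one.trans M.one_lt_u))
    (mul_pos (sub_pos.2 M.p_lt_one) M.d_pos)

/-- A random variable that ignores the move `j` is uncorrelated with the factor of that move. -/
lemma expect_mul_factor_sub_meanGrowth (j : Fin M.T) {Y : M.Sample → ℝ}
    (hY : ∀ ω b, Y (Function.update ω j b) = Y ω) :
    M.expect (fun ω => Y ω * (M.factor ω j - M.meanGrowth)) = 0 := by
  unfold expect
  -- Flipping move `j` pairs the paths without fixed points; each pair cancels because `p (u - m) +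
  -- (1 - p) (d - m) = 0`.
  refine Finset.sum_involution (fun ω _ => Function.update ω j (!ω j)) ?_ ?_
    (fun _ _ => Finset.mem_univ _) ?_
  · intro ω _
    have hprod : ∀ b, ∏ i ∈ Finset.univ.erase j,
        (if Function.update ω j b i = true then M.p else 1 - M.p)
        = ∏ i ∈ Finset.univ.erase j, (if ω i = true then M.p else 1 - M.p) := fun b =>
      Finset.prod_congr rfl fun i hi => by
        rw [Function.update_of_ne (Finset.ne_of_mem_erase hi)]
    beta_reduce
    rw [hY, prob_eq_prod, prob_eq_prod, ← Finset.mul_prod_erase _ _ (Finset.mem_univ j),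
      ← Finset.mul_prod_erase (a := j) _ _ (Finset.mem_univ j), hprod]
    simp only [factor, Function.update_self, meanGrowth]
    cases ω j <;> simp <;> ring
  · intro ω _ _ h
    have := congrFun h j
    simp at this
  · intro ω _
    simp

lemma expect_mul_price_succ {k : ℕ} (hk : k < M.T) {X : M.Sample → ℝ}
    (hX : ∀ ω ω' : M.Sample, (∀ i : Fin M.T, (i : ℕ) < k → ω i = ω' i) → X ω = X ω') :
    M.expect (fun ω => X ω * M.price (k + 1) ω)
      = M.meanGrowth * M.expect (fun ω => X ω * M.price k ω) := by
  have h := M.expect_mul_factor_sub_meanGrowth ⟨k, hk⟩ (Y := fun ω => X ω * M.price k ω) (by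
    intro ω b
    have hω : ∀ i : Fin M.T, (i : ℕ) < k → Function.update ω ⟨k, hk⟩ b i = ω i := fun i hi =>
      Function.update_of_ne (fun hik => by simp [hik] at hi) _ _
    show X _ * M.price k _ = _
    rw [hX _ _ hω, M.price_congr hω])
  rw [← expect_const_mul, ← sub_eq_zero, ← expect_sub, ← h]
  congr 1
  funext ω
  rw [M.price_succ hk]
  ring

lemma expect_mul_price {k n : ℕ} (hkn : k ≤ n) (hn : n ≤ M.T) {X : M.Sample → ℝ}
    (hX : ∀ ω ω' : M.Sample, (∀ i : Fin M.T, (i : ℕ) < k → ω i = ω' i) → X ω = X ω') :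
    M.expect (fun ω => X ω * M.price n ω)
      = M.meanGrowth ^ (n - k) * M.expect (fun ω => X ω * M.price k ω) := by
  induction n, hkn using Nat.le_induction with
  | base => simp
  | succ n hkn ih =>
    rw [M.expect_mul_price_succ hn fun ω ω' h => hX ω ω' fun i hi => h i (by omega),
      ih (by omega), Nat.succ_sub hkn, pow_succ]
    ring

/-! ### Shadow price and the wealth bound. -/

/-- The process `c m⁻ᵏ Pₖ`, a martingale when `m` is the mean growth of the stock. -/
noncomputable def discountedPrice (c : ℝ) (k : ℕ) (ω : M.Sample) : ℝ :=
  c / M.meanGrowth ^ k * M.price k ω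

lemma expect_mul_discountedPrice (c : ℝ) {k : ℕ} (hk : k ≤ M.T) {X : M.Sample → ℝ}
    (hX : ∀ ω ω' : M.Sample, (∀ i : Fin M.T, (i : ℕ) < k → ω i = ω' i) → X ω = X ω') :
    M.expect (fun ω => X ω * M.discountedPrice c M.T ω)
      = M.expect (fun ω => X ω * M.discountedPrice c k ω) := by
  have hm := M.meanGrowth_pos.ne'
  simp only [discountedPrice, mul_left_comm (X _), expect_const_mul]
  rw [M.expect_mul_price hk le_rfl hX, ← mul_assoc]
  congr 1
  rw [div_mul_eq_mul_div, div_eq_div_iff (pow_ne_zero _ hm) (pow_ne_zero _ hm), mul_assoc,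
    ← pow_add, Nat.sub_add_cancel hk]

/-- A price inside the spread favours the trader on both sides: a buyer pays no more, a seller
receives no less. -/
lemma mul_le_cost_mul {P Z : ℝ} (hl : (1 - M.lam1) * P ≤ Z) (hu : Z ≤ (1 + M.lam0) * P) (z : ℝ) :
    z * Z ≤ M.cost z * P := by
  unfold cost
  split_ifs with h
  · calc z * Z ≤ z * ((1 + M.lam0) * P) := mul_le_mul_of_nonneg_left hu h.le
      _ = _ := by ring
  · calc z * Z ≤ z * ((1 - M.lam1) * P) := mul_le_mul_of_nonpos_left hl (not_lt.1 h)
      _ = _ := by ring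

/-- If the discounted price is a shadow price, no strategy has an expected terminal wealth above
the value of the initial position at the shadow price. -/
lemma expect_wealth_le {c : ℝ}
    (hc : ∀ k ≤ M.T, 1 - M.lam1 ≤ c / M.meanGrowth ^ k ∧ c / M.meanGrowth ^ k ≤ 1 + M.lam0)
    {I : M.Strategy} (hI : M.Adapted I) (x0 x1 : ℝ) :
    M.expect (M.wealth x0 x1 I M.T) ≤ x0 + x1 * (c * M.S) := by
  have hcost : ∀ k ≤ M.T, ∀ ω z, z * M.discountedPrice c k ω ≤ M.cost z * M.price k ω :=
    fun k hk ω z => M.mul_le_cost_mul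
      (mul_le_mul_of_nonneg_right (hc k hk).1 (M.price_pos k ω).le)
      (mul_le_mul_of_nonneg_right (hc k hk).2 (M.price_pos k ω).le) z
  have hle : ∀ ω, M.wealth x0 x1 I M.T ω ≤ x0 + x1 * M.discountedPrice c M.T ω
      + ∑ l ∈ Finset.range (M.T + 1),
        (I l ω * M.discountedPrice c M.T ω - I l ω * M.discountedPrice c l ω) := by
    intro ω
    -- The final liquidation is one more trade, of minus the stock held.
    have h1 := hcost M.T le_rfl ω (-(M.stock x1 I M.T ω))
    have h2 : ∑ l ∈ Finset.range (M.T + 1), I l ω * M.discountedPrice c l ω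
        ≤ ∑ l ∈ Finset.range (M.T + 1), M.cost (I l ω) * M.price l ω :=
      Finset.sum_le_sum fun l hl => hcost l (Nat.lt_succ_iff.1 (Finset.mem_range.1 hl)) ω _
    have h3 : M.stock x1 I M.T ω * M.discountedPrice c M.T ω = x1 * M.discountedPrice c M.T ω
        + ∑ l ∈ Finset.range (M.T + 1), I l ω * M.discountedPrice c M.T ω := by
      rw [stock, add_mul, Finset.sum_mul]
    rw [Finset.sum_sub_distrib]
    unfold wealth bond
    linarith
  refine (M.expect_mono hle).trans (le_of_eq ?_)
  have h0 : M.expect (fun ω => x1 * M.discountedPrice c M.T ω) = x1 * (c * M.S) := by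
    rw [M.expect_mul_discountedPrice c (Nat.zero_le _) (X := fun _ => x1) fun _ _ _ => rfl]
    simp only [discountedPrice, price_zero, pow_zero, div_one, expect_const]
  rw [expect_add, expect_add, expect_const, h0, expect_sum, Finset.sum_eq_zero, add_zero]
  intro l hl
  have hl' : l ≤ M.T := Nat.lt_succ_iff.1 (Finset.mem_range.1 hl)
  -- Shares bought at time `l` depend only on the first `l` moves, so the martingale property makes
  -- their expected gain zero.
  rw [expect_sub, M.expect_mul_discountedPrice c hl' (hI l hl'), sub_self]

lemma wealth_closeAndHold (x0 x1 : ℝ) (k : ℕ) (ω : M.Sample) :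
    M.wealth x0 x1 (M.closeAndHold x1) k ω = x0 - M.cost (-x1) * M.S := by
  have hcost : M.cost 0 = 0 := by simp [cost]
  simp [wealth, bond, stock, closeAndHold, Finset.sum_range_succ', hcost, price_zero]

lemma admissible_closeAndHold {x0 x1 : ℝ} (hx : 0 ≤ x0 - M.cost (-x1) * M.S) :
    M.Admissible x0 x1 (M.closeAndHold x1) :=
  ⟨fun _ _ _ _ _ => rfl, fun k _ ω => by rwa [wealth_closeAndHold]⟩

/-- Closing the position at once is optimal for every concave increasing utility as soon as the
discounted price is a shadow price at which the initial position is worth its liquidation value. -/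
lemma isOptimal_closeAndHold {U : ℝ → ℝ} (hU : ConcaveOn ℝ (Set.Ici 0) U)
    (hmono : MonotoneOn U (Set.Ici 0)) {c x0 x1 : ℝ} (hx : 0 ≤ x0 - M.cost (-x1) * M.S)
    (hc : ∀ k ≤ M.T, 1 - M.lam1 ≤ c / M.meanGrowth ^ k ∧ c / M.meanGrowth ^ k ≤ 1 + M.lam0)
    (hx1 : M.cost (-x1) = -(c * x1)) :
    M.IsOptimal U x0 x1 (M.closeAndHold x1) := by
  refine ⟨M.admissible_closeAndHold hx, fun J hJ => ?_⟩
  have hJ0 : ∀ ω, 0 ≤ M.wealth x0 x1 J M.T ω := hJ.2 M.T le_rfl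
  have hle : M.expect (M.wealth x0 x1 J M.T) ≤ x0 - M.cost (-x1) * M.S := by
    refine (M.expect_wealth_le hc hJ.1 x0 x1).trans (le_of_eq ?_)
    rw [hx1]
    ring
  calc M.expectedUtility U x0 x1 J ≤ U (M.expect (M.wealth x0 x1 J M.T)) :=
        M.expect_comp_le_of_concaveOn hU hJ0
    _ ≤ U (x0 - M.cost (-x1) * M.S) := hmono (M.expect_nonneg hJ0) hx hle
    _ = M.expectedUtility U x0 x1 (M.closeAndHold x1) := by
        simp only [expectedUtility, wealth_closeAndHold, expect_const]

lemma cost_neg_of_nonpos {x : ℝ} (hx : x ≤ 0) : M.cost (-x) = -((1 + M.lam0) * x) := by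
  unfold cost
  split_ifs with h
  · ring
  · have : x = 0 := by linarith
    simp [this]

lemma cost_neg_of_nonneg {x : ℝ} (hx : 0 ≤ x) : M.cost (-x) = -((1 - M.lam1) * x) := by
  rw [cost, if_neg (by linarith)]
  ring

end BinomialMarket

lemma concaveOn_powerUtility {γ : ℝ} (h0 : 0 < γ) (h1 : γ < 1) :
    ConcaveOn ℝ (Set.Ici 0) (powerUtility γ) :=
  (Real.concaveOn_rpow h0.le h1.le).smul (one_div_pos.2 h0).le

lemma monotoneOn_powerUtility {γ : ℝ} (h0 : 0 < γ) :
    MonotoneOn (powerUtility γ) (Set.Ici 0) := fun _ hx _ _ hxy =>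
  mul_le_mul_of_nonneg_left (Real.rpow_le_rpow hx hxy h0.le) (one_div_pos.2 h0).le

theorem corollary7 (M : BinomialMarket) (γ : ℝ) (hγ0 : 0 < γ) (hγ1 : γ < 1)
    (x0 x1 : ℝ) (hx : 0 < x0 - M.cost (-x1) * M.S) :
    (1 < M.meanGrowth →
      (1 - M.lam1) * M.meanGrowth ^ M.T ≤ 1 + M.lam0 →
      x1 ≤ 0 →
      M.IsOptimal (powerUtility γ) x0 x1 (M.closeAndHold x1)) ∧
    (M.lam1 ≤ 1 →
      M.meanGrowth < 1 →
      1 - M.lam1 ≤ (1 + M.lam0) * M.meanGrowth ^ M.T →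
      0 ≤ x1 →
      M.IsOptimal (powerUtility γ) x0 x1 (M.closeAndHold x1)) := by
  have hl0 := M.lam0_pos
  have hm := M.meanGrowth_pos
  refine ⟨fun hm1 hT hx1 => ?_, fun hl1 hm1 hT hx1 => ?_⟩
  -- Here `c = 1 + λ₀`: `Z` starts at the ask price and `Z / P` decreases, so the lower bound is
  -- tightest at `T`.
  · refine M.isOptimal_closeAndHold (concaveOn_powerUtility hγ0 hγ1)
      (monotoneOn_powerUtility hγ0) hx.le (fun k hk => ?_) (M.cost_neg_of_nonpos hx1)
    have hk0 : 0 < M.meanGrowth ^ k := pow_pos hm k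
    rw [le_div_iff₀ hk0, div_le_iff₀ hk0]
    constructor
    -- If `λ₁ > 1`, the bid is negative and the lower bound is trivial.
    · rcases le_total 0 (1 - M.lam1) with h | h
      · exact (mul_le_mul_of_nonneg_left (pow_le_pow_right₀ hm1.le hk) h).trans hT
      · exact (mul_nonpos_of_nonpos_of_nonneg h hk0.le).trans (by linarith)
    · exact le_mul_of_one_le_right (by linarith) (one_le_pow₀ hm1.le)
  -- Here `c = 1 - λ₁ ≥ 0`: `Z` starts at the bid price and `Z / P` is nondecreasing, so the upper
  -- bound is tightest at `T`.
  · refine M.isOptimal_closeAndHold (concaveOn_powerUtility hγ0 hγ1)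
      (monotoneOn_powerUtility hγ0) hx.le (fun k hk => ?_) (M.cost_neg_of_nonneg hx1)
    have hk0 : 0 < M.meanGrowth ^ k := pow_pos hm k
    rw [le_div_iff₀ hk0, div_le_iff₀ hk0]
    constructor
    · exact mul_le_of_le_one_right (by linarith) (pow_le_one₀ hm.le hm1.le)
    · exact hT.trans (mul_le_mul_of_nonneg_left
        (pow_le_pow_of_le_one hm.le hm1.le hk) (by linarith))
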